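/- Let $n\ge 0$, let $\mathbb{H}(n)$ be the real vector space of $n\times n$ complex Hermitian matrices, and let $\mathbb{P}(n)\subset\mathbb{H}(n)$ be the open subset of positive definite matrices, regarded as a smooth manifold with tangent space $T_A\mathbb{P}(n)=\mathbb{H}(n)$ at every point $A$. For $A,B\in\mathbb{P}(n)$ let $$d(A,B)=\left[\operatorname{tr}A+\operatorname{tr}B-2\operatorname{tr}\bigl(A^{1/2}BA^{1/2}\bigr)^{1/2}\right]^{1/2}$$ be the Bures–Wasserstein distance, where the inner square roots are the positive semidefinite ones, and let $(AB)^{1/2}$ and $(BA)^{1/2}$ denote the unique square roots of $AB$ and $BA$ all of whose eigenvalues are positive. For $A\in\mathbb{P}(n)$ and $Y,Z\in\mathbb{H}(n)$ define $$\langle Y,Z\rangle_A=\sum_{i,j}\alpha_i\,\frac{\operatorname{Re}(\overline{y}_{ji}\,z_{ji})}{(\alpha_i+\alpha_j)^2},$$ where $A=U\operatorname{diag}(\alpha_1,\dots,\alpha_n)U^*$ with $U$ unitary, and $y_{ij}$, $z_{ij}$ are the entries of $U^*YU$ and $U^*ZU$. Then the following hold. 1. The value $\langle Y,Z\rangle_A$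 does not depend on the choice of the orthonormal eigenbasis $U$ of $A$, and $A\mapsto\langle\cdot,\cdot\rangle_A$ is a smooth Riemannian metric on $\mathbb{P}(n)$. 2. The distance function of this Riemannian metric (the infimum of the lengths of the $C^1$ curves in $\mathbb{P}(n)$ joining two points) is $d$. 3. For all $A,B\in\mathbb{P}(n)$ the curve $$A\diamond_tB=(1-t)^2A+t^2B+t(1-t)\bigl[(AB)^{1/2}+(BA)^{1/2}\bigr],\qquad 0\le t\le 1,$$ lies in $\mathbb{P}(n)$, starts at $A$ and ends at $B$, is a geodesic of this metric (its covariant acceleration for the Levi-Civita connection vanishes), and has length $d(A,B)$. -/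

import Mathlib

open scoped Matrix Manifold ContDiff MatrixOrder ComplexOrder

/- Finite-dimensional spaces of matrices carry the Frobenius norm
(inducing the usual topology on matrices). -/
attribute [local instance] Matrix.frobeniusNormedAddCommGroup Matrix.frobeniusNormedSpace

noncomputable section

namespace BuresWasserstein

/-! ### Riemannian metrics on open subsets of a normed space -/

section OpenSubsets

open scoped Bundle

variable {E : Type*} [NormedAddCommGroup E] [NormedSpace ℝ E]

/-- A smooth Riemannian metric on an open subset `U` of a normed space `E`, viewed as a manifold
(each tangent space of `U` is `E`). -/
abbrev RiemMetric (U : TopologicalSpace.Opens E) :=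
  Bundle.ContMDiffRiemannianMetric 𝓘(ℝ, E) ∞ E (fun x : U => TangentSpace 𝓘(ℝ, E) x)

variable {U : TopologicalSpace.Opens E}

/-- The inner product `⟨Y, Z⟩_x` of two tangent vectors `Y, Z ∈ E = T_x U`. -/
def RiemMetric.form (g : RiemMetric U) (x : U) (Y Z : E) : ℝ :=
  g.inner x (show TangentSpace 𝓘(ℝ, E) x from Y) (show TangentSpace 𝓘(ℝ, E) x from Z)

/-- The length, for the metric `g`, of the curve `γ` on `[a, b]`. -/
def RiemMetric.length (g : RiemMetric U) (γ : ℝ → U) (a b : ℝ) : ENNReal :=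
  letI : Bundle.RiemannianBundle (fun x : U => TangentSpace 𝓘(ℝ, E) x) := ⟨g.toRiemannianMetric⟩
  Manifold.pathELength 𝓘(ℝ, E) γ a b

/-- The distance function of the metric `g`: the infimum of the lengths of the `C^1` paths
in `U` joining two points. -/
def RiemMetric.dist (g : RiemMetric U) (x y : U) : ENNReal :=
  letI : Bundle.RiemannianBundle (fun x : U => TangentSpace 𝓘(ℝ, E) x) := ⟨g.toRiemannianMetric⟩
  Manifold.riemannianEDist 𝓘(ℝ, E) x y

/-- The derivative at `x`, in the direction `V`, of the function `y ↦ ⟨Y, Z⟩_y`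
for constant vector fields `Y, Z`. -/
def RiemMetric.dform (g : RiemMetric U) (x : U) (V Y Z : E) : ℝ :=
  mfderiv 𝓘(ℝ, E) 𝓘(ℝ, ℝ) (fun y : U => g.form y Y Z) x
    (show TangentSpace 𝓘(ℝ, E) x from V)

/-- The Christoffel symbol of the first kind, `⟨∇_Y Z, W⟩_x` for the Levi-Civita connection `∇`
of `g` and constant vector fields `Y, Z, W`. -/
def RiemMetric.christoffel (g : RiemMetric U) (x : U) (Y Z W : E) : ℝ :=
  (g.dform x Y Z W + g.dform x Z Y W - g.dform x W Y Z) / 2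

/-- `γ` is a geodesic of `g` on the interval `s`: it is twice differentiable there
(`v` and `a` are its first and second derivatives in `E`), and its covariant acceleration
`∇_{γ'} γ'`, tested against every tangent vector `W`, vanishes. -/
def RiemMetric.IsGeodesicOn (g : RiemMetric U) (γ : ℝ → U) (s : Set ℝ) : Prop :=
  ∃ v a : ℝ → E, ∀ t ∈ s,
    HasDerivWithinAt (fun r => (γ r : E)) (v t) s t ∧
    HasDerivWithinAt v (a t) s t ∧
    ∀ W : E, g.form (γ t) (a t) W + g.christoffel (γ t) (v t) (v t) W = 0

end OpenSubsets

/-! ### Hermitian and positive definite matrices -/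

/-- The real vector space of `n × n` complex Hermitian matrices. -/
abbrev Herm (n : ℕ) : Submodule ℝ (Matrix (Fin n) (Fin n) ℂ) :=
  selfAdjoint.submodule ℝ (Matrix (Fin n) (Fin n) ℂ)

theorem isOpen_posDef (n : ℕ) :
    IsOpen {A : Herm n | (A : Matrix (Fin n) (Fin n) ℂ).PosDef} := by
  let f : Herm n × Metric.sphere (0 : EuclideanSpace ℂ (Fin n)) 1 → ℝ := fun p =>
    (star (p.2 : EuclideanSpace ℂ (Fin n)).ofLp ⬝ᵥ
      ((p.1 : Matrix (Fin n) (Fin n) ℂ) *ᵥ (p.2 : EuclideanSpace ℂ (Fin n)).ofLp)).re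
  have hf : Continuous f := by
    have h1 : Continuous fun p : Herm n × Metric.sphere (0 : EuclideanSpace ℂ (Fin n)) 1 =>
        (p.1 : Matrix (Fin n) (Fin n) ℂ) := continuous_subtype_val.comp continuous_fst
    have h2 : Continuous fun p : Herm n × Metric.sphere (0 : EuclideanSpace ℂ (Fin n)) 1 =>
        (p.2 : EuclideanSpace ℂ (Fin n)).ofLp :=
      (PiLp.continuous_ofLp 2 _).comp (continuous_subtype_val.comp continuous_snd)
    exact Complex.continuous_re.comp (h2.star.dotProduct (h1.matrix_mulVec h2))
  have hcl : IsClosed (Prod.fst '' {p | f p ≤ 0}) :=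
    isClosedMap_fst_of_compactSpace _ (isClosed_le hf continuous_const)
  convert hcl.isOpen_compl using 1
  ext A
  have hA : (A : Matrix (Fin n) (Fin n) ℂ).IsHermitian := A.2
  simp only [Set.mem_ofPred_eq, Set.mem_compl_iff, Set.mem_image, not_exists, not_and]
  constructor
  · rintro h ⟨B, x⟩ hx rfl
    have hx0 : (x : EuclideanSpace ℂ (Fin n)).ofLp ≠ 0 := by
      intro h0
      have : (x : EuclideanSpace ℂ (Fin n)) = 0 := (WithLp.ofLp_injective 2) h0
      have h1 := x.2
      rw [this] at h1
      simp at h1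
    have := (Complex.pos_iff.1 (h.dotProduct_mulVec_pos hx0)).1
    exact absurd hx (not_le.2 this)
  · intro h
    refine Matrix.posDef_iff_dotProduct_mulVec.2 ⟨hA, fun x hx => ?_⟩
    set y : EuclideanSpace ℂ (Fin n) := WithLp.toLp 2 x with hy
    have hy0 : y ≠ 0 := fun h0 => hx (by rw [← WithLp.ofLp_toLp 2 x, ← hy, h0]; rfl)
    have hn : ‖y‖ ≠ 0 := norm_ne_zero_iff.2 hy0
    have hpos : 0 < f (A, ⟨((‖y‖⁻¹ : ℝ) : ℂ) • y, by
        simp [norm_smul, hn]⟩) := by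
      by_contra hc
      exact h _ (not_lt.1 hc) rfl
    rw [Complex.pos_iff]
    constructor
    · have : f (A, ⟨((‖y‖⁻¹ : ℝ) : ℂ) • y, by simp [norm_smul, hn]⟩)
          = ‖y‖⁻¹ * (‖y‖⁻¹ * (star x ⬝ᵥ ((A : Matrix (Fin n) (Fin n) ℂ) *ᵥ x)).re) := by
        simp only [f, WithLp.ofLp_smul, star_smul, Matrix.mulVec_smul, smul_dotProduct,
          dotProduct_smul, smul_eq_mul, Complex.star_def, Complex.conj_ofReal, Complex.re_ofReal_mul]
        rfl
      rw [this] at hpos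
      have hi : 0 < ‖y‖⁻¹ := by positivity
      exact (mul_pos_iff_of_pos_left hi).1 ((mul_pos_iff_of_pos_left hi).1 hpos)
    · exact (hA.im_star_dotProduct_mulVec_self x).symm

/-- The set of positive definite matrices, an open subset of the Hermitian matrices. -/
def Pos (n : ℕ) : TopologicalSpace.Opens (Herm n) :=
  ⟨{A : Herm n | (A : Matrix (Fin n) (Fin n) ℂ).PosDef}, isOpen_posDef n⟩

/-- The underlying complex matrix of a positive definite matrix. -/
def toMat {n : ℕ} (A : Pos n) : Matrix (Fin n) (Fin n) ℂ := ((A : Herm n) : Matrix _ _ ℂ)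

/-- The Bures-Wasserstein distance
`d(A, B) = (tr A + tr B - 2 tr (A^{1/2} B A^{1/2})^{1/2})^{1/2}`, where the inner square roots
are positive semidefinite square roots of positive semidefinite matrices. -/
def bwDist {n : ℕ} (A B : Matrix (Fin n) (Fin n) ℂ) : ℝ :=
  √(A.trace + B.trace - 2 * (CFC.sqrt (CFC.sqrt A * B * CFC.sqrt A)).trace).re

/-- For `A = U diag(α) U*`, with `y`, `z` the entries of the matrices `U* Y U`, `U* Z U` of
`Y`, `Z` in the orthonormal eigenbasis given by the columns of `U`, the sum
`∑ i j, α_i Re(conj(y_ji) z_ji) / (α_i + α_j)²`. -/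
def eigenbasisForm {n : ℕ} (U : Matrix (Fin n) (Fin n) ℂ) (α : Fin n → ℝ)
    (Y Z : Matrix (Fin n) (Fin n) ℂ) : ℝ :=
  ∑ i, ∑ j, α i * (star ((Uᴴ * Y * U) j i) * (Uᴴ * Z * U) j i).re / (α i + α j) ^ 2

/-- `R` is a square root of `X` all of whose eigenvalues are positive. -/
def IsPosSqrt {n : ℕ} (X R : Matrix (Fin n) (Fin n) ℂ) : Prop :=
  R * R = X ∧ ∀ z ∈ spectrum ℂ R, 0 < z

/-- A matrix has at most one square root with positive eigenvalues. -/
theorem IsPosSqrt.unique {n : ℕ} {X R S : Matrix (Fin n) (Fin n) ℂ}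
    (hR : IsPosSqrt X R) (hS : IsPosSqrt X S) : R = S := by
  have hc : R * (R - S) = (R - S) * (-S) := by
    have h := hR.1.trans hS.1.symm
    rw [mul_sub, sub_mul, mul_neg, mul_neg, h]
    abel
  have hp : ∀ p : Polynomial ℂ,
      Polynomial.aeval R p * (R - S) = (R - S) * Polynomial.aeval (-S) p := by
    intro p
    induction p using Polynomial.induction_on' with
    | add p q hp hq => simp only [map_add, add_mul, mul_add, hp, hq]
    | monomial k c =>
      have hk : R ^ k * (R - S) = (R - S) * (-S) ^ k :=
        (SemiconjBy.pow_right (show SemiconjBy (R - S) (-S) R from hc.symm) k).eq.symm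
      simp only [Polynomial.aeval_monomial, mul_assoc, hk]
      rw [← mul_assoc, Algebra.commutes, mul_assoc]
  rcases Nat.eq_zero_or_pos n with rfl | hn
  · exact Subsingleton.elim _ _
  have : Nonempty (Fin n) := ⟨⟨0, hn⟩⟩
  have h0 := hp (-S).charpoly
  rw [Matrix.aeval_self_charpoly, mul_zero] at h0
  have hu : IsUnit (Polynomial.aeval R (-S).charpoly) := by
    by_contra hu
    have hz : (0 : ℂ) ∈ spectrum ℂ (Polynomial.aeval R (-S).charpoly) :=
      spectrum.zero_mem ℂ hu
    rw [spectrum.map_polynomial_aeval_of_degree_pos _ _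
      (by rw [Matrix.charpoly_degree_eq_dim]; simpa using hn)] at hz
    obtain ⟨z, hzR, hz⟩ := hz
    have h1 : z ∈ spectrum ℂ (-S) := Matrix.mem_spectrum_of_isRoot_charpoly hz
    rw [← spectrum.neg_eq, Set.mem_neg] at h1
    have h2 := add_pos (hR.2 z hzR) (hS.2 _ h1)
    simp at h2
  exact sub_eq_zero.1 (hu.mul_right_eq_zero.1 h0)

/-- The product of two positive definite matrices has a square root with positive eigenvalues. -/
theorem exists_isPosSqrt {n : ℕ} {A B : Matrix (Fin n) (Fin n) ℂ} (hA : A.PosDef) (hB : B.PosDef) :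
    ∃ R, IsPosSqrt (A * B) R := by
  have hP : (CFC.sqrt A).PosDef := Matrix.isStrictlyPositive_iff_posDef.1
    (Matrix.isStrictlyPositive_iff_posDef.2 hA).sqrt
  set P := CFC.sqrt A with hPdef
  have hPP : P * P = A := CFC.sqrt_mul_sqrt_self A hA.posSemidef.nonneg
  have hPBP : (P * B * P).PosDef := by
    have := hB.mul_mul_conjTranspose_same (B := P) (Matrix.vecMul_injective_of_isUnit hP.isUnit)
    rwa [hP.isHermitian.eq] at this
  have hC : (CFC.sqrt (P * B * P)).PosDef := Matrix.isStrictlyPositive_iff_posDef.1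
    (Matrix.isStrictlyPositive_iff_posDef.2 hPBP).sqrt
  have hCC : CFC.sqrt (P * B * P) * CFC.sqrt (P * B * P) = P * B * P :=
    CFC.sqrt_mul_sqrt_self _ hPBP.posSemidef.nonneg
  obtain ⟨u, hu⟩ := hP.isUnit
  refine ⟨u.val * CFC.sqrt (P * B * P) * (u⁻¹).val, ?_, ?_⟩
  · calc _ = u.val * (CFC.sqrt (P * B * P) * CFC.sqrt (P * B * P)) * (u⁻¹).val := by
          simp [mul_assoc]
      _ = A * B := by
          rw [hCC, ← hPP, ← hu]
          simp [mul_assoc]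
  · intro z hz
    rw [spectrum.units_conjugate] at hz
    rw [hC.isHermitian.spectrum_eq_image_range] at hz
    obtain ⟨_, ⟨i, rfl⟩, rfl⟩ := hz
    exact Complex.zero_lt_real.2 (hC.eigenvalues_pos i)

open Classical in
/-- The square root `X^{1/2}` with positive eigenvalues, for matrices `X` that have one
(and `0` otherwise). -/
def posSqrt {n : ℕ} (X : Matrix (Fin n) (Fin n) ℂ) : Matrix (Fin n) (Fin n) ℂ :=
  if h : ∃ R, IsPosSqrt X R then h.choose else 0

theorem isPosSqrt_posSqrt {n : ℕ} {A B : Matrix (Fin n) (Fin n) ℂ}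
    (hA : A.PosDef) (hB : B.PosDef) : IsPosSqrt (A * B) (posSqrt (A * B)) := by
  rw [posSqrt, dif_pos (exists_isPosSqrt hA hB)]
  exact (exists_isPosSqrt hA hB).choose_spec

/-- `A ◇_t B = (1-t)² A + t² B + t(1-t) [(AB)^{1/2} + (BA)^{1/2}]`. -/
def diamond {n : ℕ} (A B : Matrix (Fin n) (Fin n) ℂ) (t : ℝ) : Matrix (Fin n) (Fin n) ℂ :=
  (1 - t) ^ 2 • A + t ^ 2 • B + (t * (1 - t)) • (posSqrt (A * B) + posSqrt (B * A))

end BuresWasserstein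

end

open BuresWasserstein

/-! For positive definite `A` the map `X ↦ A X + X A` is invertible on Hermitian matrices. In an
eigenbasis of `A` it multiplies the entry `(i, j)` by `α_i + α_j`, and symmetrizing the sum in `i`
and `j` gives `⟨Y, Z⟩_A = (1/2) Re tr (Y X)` with `A X + X A = Z`. This expression involves no
eigenbasis, and it is smooth in `A` because inversion of operators is smooth. The metric, its
Christoffel symbols and its geodesic equation need only a symmetric form and a commutative product
with symmetric multiplication operators, positive definite at the points of the open set;
`LyapunovData` records exactly this.

Let `S` be the positive definite matrix with `S A S = B`. Then `d(A, B)² = tr ((1 - S) A (1 - S))`.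

Lower bound (`ofReal_bwDist_le_dist`): fix `B` and let `F P = d(P, B)²`. At each `P`, with `S P S =
B`, `F` has the supporting functional `V ↦ Re tr ((1 - S) V)` (`two_mul_trace_transport_le`). By
Cauchy-Schwarz its descent slope is at most `2 √F` times the Riemannian norm of `V`. So `√F`
decreases along a curve by at most its length, and `F B = 0`.

Upper bound (`exists_geodesic`): with `T A T = B` and `M = 1 + t (T - 1)`, the curve `A ◇_t B`
equals `M A M`. It is quadratic in `t`, satisfies the geodesic equation, and has constant speed
`d(A, B)`. -/

namespace BuresWasserstein

open Bundle Set MeasureTheory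
open scoped Topology ENNReal

/-! ### Riemannian metrics on an open set in ambient coordinates -/

section OpenSubsets

variable {E : Type*} [NormedAddCommGroup E] [NormedSpace ℝ E] {U : TopologicalSpace.Opens E}

theorem extChartAt_opens_apply (x y : U) : extChartAt 𝓘(ℝ, E) x y = (y : E) := rfl

theorem val_extChartAt_opens_symm (x : U) {y : E} (hy : y ∈ U) :
    ((extChartAt 𝓘(ℝ, E) x).symm y : E) = y := by
  have h : (extChartAt 𝓘(ℝ, E) x).symm (extChartAt 𝓘(ℝ, E) x ⟨y, hy⟩) = ⟨y, hy⟩ :=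
    (extChartAt 𝓘(ℝ, E) x).left_inv (by
      rw [extChartAt_source, TopologicalSpace.Opens.chartAt_eq,
        OpenPartialHomeomorph.subtypeRestr_source]
      exact mem_univ _)
  rw [extChartAt_opens_apply] at h
  rw [h]

theorem hasMFDerivAt_opens_val (x : U) :
    HasMFDerivAt 𝓘(ℝ, E) 𝓘(ℝ, E) (Subtype.val : U → E) x (ContinuousLinearMap.id ℝ E) := by
  refine ⟨continuous_subtype_val.continuousAt, ?_⟩
  have h : writtenInExtChartAt 𝓘(ℝ, E) 𝓘(ℝ, E) x (Subtype.val : U → E) =ᶠ[𝓝 (x : E)] id := by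
    filter_upwards [U.isOpen.mem_nhds x.2] with y hy
    exact val_extChartAt_opens_symm x hy
  exact ((hasFDerivAt_id (x : E)).congr_of_eventuallyEq h).hasFDerivWithinAt

theorem contMDiffOn_opens_iff {γ : ℝ → U} {s : Set ℝ} {k : WithTop ℕ∞} :
    ContMDiffOn 𝓘(ℝ, ℝ) 𝓘(ℝ, E) k γ s ↔ ContDiffOn ℝ k (fun t => (γ t : E)) s := by
  rw [← contMDiffOn_iff_contDiffOn]
  refine ⟨fun h => contMDiff_subtype_val.comp_contMDiffOn h, fun h t ht => ?_⟩
  rw [contMDiffWithinAt_iff]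
  refine ⟨Topology.IsInducing.subtypeVal.continuousWithinAt_iff.2 (h.continuousOn t ht), ?_⟩
  exact (contMDiffWithinAt_iff.1 (h t ht)).2

theorem mfderivWithin_opens_apply {γ : ℝ → U} {s : Set ℝ} {t : ℝ} {v : E}
    (hc : ContMDiffOn 𝓘(ℝ, ℝ) 𝓘(ℝ, E) 1 γ s) (hs : UniqueDiffOn ℝ s) (ht : t ∈ s)
    (h : HasDerivWithinAt (fun r => (γ r : E)) v s t) :
    (mfderivWithin 𝓘(ℝ, ℝ) 𝓘(ℝ, E) γ s t (1 : ℝ) : E) = v := by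
  have h1 := (hc.mdifferentiableOn one_ne_zero t ht).hasMFDerivWithinAt
  obtain ⟨L, hL⟩ : ∃ L : ℝ →L[ℝ] E, L = mfderivWithin 𝓘(ℝ, ℝ) 𝓘(ℝ, E) γ s t := ⟨_, rfl⟩
  rw [← hL] at h1 ⊢
  have h2 : HasMFDerivWithinAt 𝓘(ℝ, ℝ) 𝓘(ℝ, E) (Subtype.val ∘ γ) s t
      ((ContinuousLinearMap.id ℝ E).comp L) :=
    (hasMFDerivAt_opens_val (γ t)).comp_hasMFDerivWithinAt t h1
  have h3 : HasFDerivWithinAt (fun r => (γ r : E)) L s t :=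
    (hasMFDerivWithinAt_iff_hasFDerivWithinAt (f' := L)).1 h2
  have h4 : L 1 = v := UniqueDiffWithinAt.eq_deriv s (hs t ht) h3.hasDerivWithinAt h
  exact h4

namespace RiemMetric

theorem length_eq_lintegral (g : RiemMetric U) {γ : ℝ → U} {v : ℝ → E} {a b : ℝ} (hab : a < b)
    (hc : ContDiffOn ℝ 1 (fun t => (γ t : E)) (Icc a b))
    (h : ∀ t ∈ Icc a b, HasDerivWithinAt (fun r => (γ r : E)) (v t) (Icc a b) t) :
    g.length γ a b = ∫⁻ t in Icc a b, ENNReal.ofReal √(g.form (γ t) (v t) (v t)) := by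
  let : RiemannianBundle (fun x : U => TangentSpace 𝓘(ℝ, E) x) := ⟨g.toRiemannianMetric⟩
  change Manifold.pathELength 𝓘(ℝ, E) γ a b = _
  rw [Manifold.pathELength_eq_lintegral_mfderivWithin_Icc]
  refine setLIntegral_congr_fun measurableSet_Icc fun t ht => ?_
  have h1 := mfderivWithin_opens_apply (contMDiffOn_opens_iff.2 hc) (uniqueDiffOn_Icc hab) ht (h t ht)
  have key : ∀ w : TangentSpace 𝓘(ℝ, E) (γ t),
      ‖w‖ₑ = ENNReal.ofReal √(g.form (γ t) w w) := by
    intro w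
    rw [← ofReal_norm, norm_eq_sqrt_real_inner]
    rfl
  exact (key _).trans (congrArg (fun w : E => ENNReal.ofReal √(g.form (γ t) w w)) h1)

theorem dist_le_length (g : RiemMetric U) {γ : ℝ → U} {a b : ℝ} (hab : a ≤ b)
    (hc : ContDiffOn ℝ 1 (fun t => (γ t : E)) (Icc a b)) :
    g.dist (γ a) (γ b) ≤ g.length γ a b := by
  let : RiemannianBundle (fun x : U => TangentSpace 𝓘(ℝ, E) x) := ⟨g.toRiemannianMetric⟩
  exact Manifold.riemannianEDist_le_pathELength (contMDiffOn_opens_iff.2 hc) rfl rfl hab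

theorem exists_length_lt (g : RiemMetric U) {x y : U} {r : ℝ≥0∞} (h : g.dist x y < r) :
    ∃ γ : ℝ → U, γ 0 = x ∧ γ 1 = y ∧ ContDiffOn ℝ 1 (fun t => (γ t : E)) (Icc 0 1) ∧
      g.length γ 0 1 < r := by
  let : RiemannianBundle (fun x : U => TangentSpace 𝓘(ℝ, E) x) := ⟨g.toRiemannianMetric⟩
  obtain ⟨γ, h0, h1, hc, hl⟩ := Manifold.exists_lt_of_riemannianEDist_lt h
  exact ⟨γ, h0, h1, contMDiffOn_opens_iff.1 hc, hl⟩

/-- A bilinear form on the ambient space, viewed on the tangent space at `x`. -/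
def bilinAt (B : E → E →L[ℝ] E →L[ℝ] ℝ) (x : U) :
    TangentSpace 𝓘(ℝ, E) x →L[ℝ] TangentSpace 𝓘(ℝ, E) x →L[ℝ] ℝ := B x

/-- The charts of `U` at `x` and at `y` are both the inclusion into `E`, so the change of
coordinates between them is that of a chart with itself. -/
theorem trivializationAt_opens_symm (x y : U) (v : E) :
    (trivializationAt E (TangentSpace 𝓘(ℝ, E)) x).symm y v = v := by
  have hy : y ∈ (chartAt E x).source := mem_chart_source E y
  have h := TangentBundle.symmL_trivializationAt_eq_core (I := 𝓘(ℝ, E)) hy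
  have h2 := congrArg (fun f : E →L[ℝ] E => f v) h
  exact (Trivialization.symmL_apply (R := ℝ) _ hy v).symm.trans <| h2.trans ((tangentBundleCore 𝓘(ℝ, E) U).coordChange_self (achart E y) y hy v)

/-- Since the trivializations of the tangent bundle act as the identity, the coordinate expression
of this section is `B` itself. -/
theorem contMDiff_bilinAt {B : E → E →L[ℝ] E →L[ℝ] ℝ} {k : WithTop ℕ∞} (hB : ContDiffOn ℝ k B U) :
    ContMDiff 𝓘(ℝ, E) (𝓘(ℝ, E).prod 𝓘(ℝ, E →L[ℝ] E →L[ℝ] ℝ)) k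
      (fun x : U => TotalSpace.mk' (E →L[ℝ] E →L[ℝ] ℝ)
        (E := fun x : U => TangentSpace 𝓘(ℝ, E) x →L[ℝ] TangentSpace 𝓘(ℝ, E) x →L[ℝ] ℝ)
        x (bilinAt B x)) := by
  intro x
  rw [contMDiffAt_hom_bundle]
  refine ⟨contMDiffAt_id, ?_⟩
  have h1 : ContMDiffAt 𝓘(ℝ, E) 𝓘(ℝ, E →L[ℝ] E →L[ℝ] ℝ) k (fun y : U => B y) x :=
    ContMDiffAt.comp x ((hB.contDiffAt (U.isOpen.mem_nhds x.2)).contMDiffAt)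
      contMDiff_subtype_val.contMDiffAt
  refine h1.congr_of_eventuallyEq (Filter.Eventually.of_forall fun y => ?_)
  ext v w
  have hy : y ∈ (trivializationAt E (TangentSpace 𝓘(ℝ, E)) x).baseSet := mem_chart_source E y
  dsimp only
  rw [inCoordinates_apply_eq₂ hy hy (mem_univ _)]
  have h2 : ∀ r : ℝ,
      (trivializationAt ℝ (fun _ : U => ℝ) x).linearMapAt ℝ y r = r := fun r => by simp
  refine (h2 _).trans ?_
  rw [trivializationAt_opens_symm]
  exact congrArg (B y v) (trivializationAt_opens_symm x y w)

/-- The smooth Riemannian metric given by a family of bilinear forms on the ambient space. -/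
def ofBilin (B : E → E →L[ℝ] E →L[ℝ] ℝ) (hB : ContDiffOn ℝ ∞ B U)
    (symm : ∀ x ∈ U, ∀ v w, B x v w = B x w v) (pos : ∀ x ∈ U, ∀ v, v ≠ 0 → 0 < B x v v)
    (bdd : ∀ x ∈ U, Bornology.IsBounded {v : E | B x v v < 1}) : RiemMetric U where
  inner x := bilinAt B x
  symm x := symm x x.2
  pos x := pos x x.2
  isVonNBounded x := NormedSpace.isVonNBounded_of_isBounded (E := E) ℝ (bdd x x.2)
  contMDiff := contMDiff_bilinAt hB

theorem dform_eq (g : RiemMetric U) {x : U} {Y Z V : E} {f : E → ℝ} {f' : E →L[ℝ] ℝ}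
    (hf : ∀ y : U, g.form y Y Z = f y) (h : HasFDerivAt f f' x) : g.dform x V Y Z = f' V := by
  have h1 : HasMFDerivAt 𝓘(ℝ, E) 𝓘(ℝ, ℝ) (f ∘ (Subtype.val : U → E)) x
      (f'.comp (ContinuousLinearMap.id ℝ E)) :=
    HasMFDerivAt.comp x h.hasMFDerivAt (hasMFDerivAt_opens_val x)
  have h2 : (fun y : U => g.form y Y Z) = f ∘ Subtype.val := funext hf
  rw [dform, h2, h1.mfderiv]
  rfl

end RiemMetric

end OpenSubsets

end BuresWasserstein

/-! ### The metric and Christoffel symbols of a symmetric product -/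

namespace BuresWasserstein

open Set
open scoped Topology

/-- By compactness of the unit sphere `B v v ≥ c > 0` there, and homogeneity bounds `‖v‖²` by `1 /
c`. -/
theorem isBounded_lt_one_of_pos {E : Type*} [NormedAddCommGroup E] [NormedSpace ℝ E]
    [FiniteDimensional ℝ E] (B : E →L[ℝ] E →L[ℝ] ℝ) (hB : ∀ v, v ≠ 0 → 0 < B v v) :
    Bornology.IsBounded {v : E | B v v < 1} := by
  have : ProperSpace E := FiniteDimensional.proper_real E
  obtain ⟨c, hc, hcB⟩ := (isCompact_sphere (0 : E) 1).exists_forall_le' (f := fun v => B v v)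
    (by fun_prop) (a := 0) fun v hv => hB v (by rintro rfl; simp at hv)
  refine (Metric.isBounded_closedBall (x := (0 : E)) (r := √(1 / c))).subset fun v hv => ?_
  rcases eq_or_ne v 0 with rfl | h0
  · simp
  have h1 := hcB (‖v‖⁻¹ • v) (by simp [norm_smul, h0])
  have hn : 0 < ‖v‖ := norm_pos_iff.2 h0
  simp only [map_smul, FunLike.coe_smul, Pi.smul_apply, smul_eq_mul] at h1
  rw [← mul_assoc, ← mul_inv, inv_mul_eq_div, le_div_iff₀ (by positivity)] at h1
  rw [mem_closedBall_zero_iff]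
  refine Real.le_sqrt_of_sq_le ?_
  rw [le_div_iff₀ hc]
  have h2 : B v v < 1 := hv
  nlinarith

/-- The data from which the metric is built: a symmetric bilinear form `form` and a commutative
product `mul` whose multiplication operators are symmetric, such that those by points of `U` are
positive definite. -/
structure LyapunovData {E : Type*} [NormedAddCommGroup E] [NormedSpace ℝ E]
    (U : TopologicalSpace.Opens E) where
  /-- The bilinear form. -/
  form : E →ₗ[ℝ] E →ₗ[ℝ] ℝ
  /-- The commutative product. -/
  mul : E →ₗ[ℝ] E →ₗ[ℝ] E
  form_symm (Y X : E) : form Y X = form X Y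
  mul_comm (A X : E) : mul A X = mul X A
  form_mul_left (A X Y : E) : form (mul A X) Y = form X (mul A Y)
  form_mul_self_pos {A : E} (hA : A ∈ U) {X : E} (hX : X ≠ 0) : 0 < form (mul A X) X

namespace LyapunovData

variable {E : Type*} [NormedAddCommGroup E] [NormedSpace ℝ E] [FiniteDimensional ℝ E]
  {U : TopologicalSpace.Opens E} (D : LyapunovData U)

/-- The product as a continuous bilinear map. -/
noncomputable def mulL : E →L[ℝ] E →L[ℝ] E := D.mul.toContinuousBilinearMap

theorem mulL_apply (A X : E) : D.mulL A X = D.mul A X := rfl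

/-- Positivity makes multiplication by `A` injective, hence bijective in finite dimension. -/
theorem isUnit_mulL {A : E} (hA : A ∈ U) : IsUnit (D.mulL A) := by
  have : CompleteSpace E := FiniteDimensional.complete ℝ E
  have hinj : Function.Injective (D.mulL A) := by
    rw [injective_iff_map_eq_zero]
    intro X hX
    by_contra h0
    have := D.form_mul_self_pos hA h0
    rw [← mulL_apply, hX] at this
    simp at this
  rw [ContinuousLinearMap.isUnit_iff_bijective]
  exact ⟨hinj, (LinearMap.injective_iff_surjective (f := (D.mulL A).toLinearMap)).1 hinj⟩

/-- The inverse of multiplication by `A`. -/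
noncomputable def lyap (A : E) : E →L[ℝ] E := Ring.inverse (D.mulL A)

theorem mul_lyap {A : E} (hA : A ∈ U) (Z : E) : D.mul A (D.lyap A Z) = Z :=
  congrArg (fun f : E →L[ℝ] E => f Z) (Ring.mul_inverse_cancel _ (D.isUnit_mulL hA))

theorem lyap_mul {A : E} (hA : A ∈ U) (Z : E) : D.lyap A (D.mul A Z) = Z :=
  congrArg (fun f : E →L[ℝ] E => f Z) (Ring.inverse_mul_cancel _ (D.isUnit_mulL hA))

theorem form_lyap_symm {A : E} (hA : A ∈ U) (Y Z : E) :
    D.form Y (D.lyap A Z) = D.form Z (D.lyap A Y) := by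
  conv_lhs => rw [← D.mul_lyap hA Y]
  rw [D.form_mul_left, D.mul_lyap hA, D.form_symm]

theorem contDiffOn_lyap {k : WithTop ℕ∞} : ContDiffOn ℝ k D.lyap U := by
  have : CompleteSpace E := FiniteDimensional.complete ℝ E
  intro A hA
  obtain ⟨u, hu⟩ := D.isUnit_mulL hA
  refine ContDiffAt.contDiffWithinAt ?_
  have h1 : ContDiffAt ℝ k (Ring.inverse : (E →L[ℝ] E) → _) (D.mulL A) :=
    hu ▸ contDiffAt_ringInverse ℝ u
  exact h1.comp A D.mulL.contDiff.contDiffAt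

/-- This is the derivative `-L⁻¹ (dL) L⁻¹` of an operator inverse, for `L` the multiplication by
`A`, which is linear in `A`. -/
theorem hasFDerivAt_lyap_apply {A : E} (hA : A ∈ U) (Z : E) :
    HasFDerivAt (fun P : E => D.lyap P Z)
      (-(D.lyap A).comp (D.mulL.flip (D.lyap A Z))) A := by
  have : CompleteSpace E := FiniteDimensional.complete ℝ E
  obtain ⟨u, hu⟩ := D.isUnit_mulL hA
  have h0 : D.lyap A = ↑u⁻¹ := by rw [lyap, ← hu, Ring.inverse_unit]
  have h1 := hasFDerivAt_ringInverse (𝕜 := ℝ) u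
  rw [hu] at h1
  have h2 := (h1.comp A D.mulL.hasFDerivAt).clm_apply (hasFDerivAt_const Z A)
  refine h2.congr_fderiv ?_
  ext V
  simp [h0]

/-- The bilinear form `form Y X` with `mul A X = Z`. -/
noncomputable def bilin (A : E) : E →L[ℝ] E →L[ℝ] ℝ :=
  ((ContinuousLinearMap.compL ℝ E E ℝ).flip (D.lyap A)).comp D.form.toContinuousBilinearMap

theorem bilin_pos {A : E} (hA : A ∈ U) {Z : E} (hZ : Z ≠ 0) : 0 < D.bilin A Z Z := by
  have h : D.lyap A Z ≠ 0 := fun h => hZ (by rw [← D.mul_lyap hA Z, h, map_zero])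
  have := D.form_mul_self_pos hA h
  rwa [D.mul_lyap hA] at this

theorem contDiffOn_bilin {k : WithTop ℕ∞} : ContDiffOn ℝ k D.bilin U := by
  have h1 : ContDiff ℝ k fun J : E →L[ℝ] E =>
      ((ContinuousLinearMap.compL ℝ E E ℝ).flip J).comp D.form.toContinuousBilinearMap := by
    fun_prop
  exact h1.comp_contDiffOn D.contDiffOn_lyap

/-- The Riemannian metric `⟨Y, Z⟩_A = form Y X` with `mul A X = Z`. -/
noncomputable def metric : RiemMetric U :=
  RiemMetric.ofBilin D.bilin D.contDiffOn_bilin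
    (fun _ hA Y Z => D.form_lyap_symm hA Y Z) (fun _ hA _ hZ => D.bilin_pos hA hZ)
    (fun _ hA => isBounded_lt_one_of_pos _ fun _ hZ => D.bilin_pos hA hZ)

theorem metric_form (A : U) (Y Z : E) : D.metric.form A Y Z = D.form Y (D.lyap (A : E) Z) := rfl

theorem metric_form_mul (A : U) (X : E) :
    D.metric.form A (D.mul A X) (D.mul A X) = D.form (D.mul A X) X := by
  rw [metric_form, D.lyap_mul A.2]

theorem metric_dform (A : U) (V Y Z : E) :
    D.metric.dform A V Y Z = -D.form (D.lyap (A : E) Y) (D.mul V (D.lyap (A : E) Z)) := by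
  have h1 : HasFDerivAt (fun P => D.form.toContinuousBilinearMap Y (D.lyap P Z))
      ((D.form.toContinuousBilinearMap Y).comp
        (-(D.lyap A).comp (D.mulL.flip (D.lyap A Z)))) (A : E) :=
    (D.form.toContinuousBilinearMap Y).hasFDerivAt.comp (A : E) (D.hasFDerivAt_lyap_apply A.2 Z)
  rw [D.metric.dform_eq (fun P => D.metric_form P Y Z) h1]
  have h2 : ∀ W : E, D.form.toContinuousBilinearMap Y (-(D.lyap (A : E) W))
      = -D.form (D.lyap (A : E) Y) W := by
    intro W
    rw [map_neg, LinearMap.toContinuousBilinearMap_apply, D.form_lyap_symm A.2, D.form_symm]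
  exact h2 _

/-- In terms of `X` with `mul A X = v`, the covariant acceleration of a curve through `A` with
velocity `v` and acceleration `a` vanishes when `a = v X - (1/2) A (X X)`. -/
theorem form_add_christoffel_eq_zero (A : U) {X v a : E} (hv : D.mul A X = v)
    (ha : a = D.mul v X - (1 / 2 : ℝ) • D.mul A (D.mul X X)) (W : E) :
    D.metric.form A a W + D.metric.christoffel A v v W = 0 := by
  have hX : D.lyap (A : E) v = X := by rw [← hv, D.lyap_mul A.2]
  -- With the test vector written as `A K`, every term becomes a pairing with `K`: the Christoffel
  -- term is `-form (v X) K + (1/2) form (A (X X)) K`.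
  obtain ⟨K, rfl⟩ : ∃ K, D.mul A K = W := ⟨_, D.mul_lyap A.2 W⟩
  have hK : D.lyap (A : E) (D.mul A K) = K := D.lyap_mul A.2 K
  simp only [RiemMetric.christoffel, metric_dform, metric_form, hK, hX]
  have h1 : D.form X (D.mul v K) = D.form (D.mul v X) K := (D.form_mul_left ..).symm
  have h2 : D.form X (D.mul (D.mul A K) X) = D.form (D.mul A (D.mul X X)) K := by
    rw [D.mul_comm _ X, ← D.form_mul_left, D.form_symm, D.form_mul_left, D.form_symm]
  have h4 : D.form K (D.mul v X) = D.form (D.mul v X) K := D.form_symm ..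
  have h3 : D.form a K = D.form (D.mul v X) K - 1 / 2 * D.form (D.mul A (D.mul X X)) K := by
    rw [ha]; simp
  rw [h2, h3, h1]
  ring

end LyapunovData

end BuresWasserstein

/-! ### Distance bounds from support functions, and quadratic geodesics -/

namespace BuresWasserstein

open Set MeasureTheory
open scoped Topology

/-- In the weighted sum of the two support inequalities at `z = a x + b y`, the linear terms cancel.
-/
theorem convexOn_of_support {E : Type*} [AddCommGroup E] [Module ℝ E] {s : Set E}
    (hs : Convex ℝ s) {F : E → ℝ} {l : E → E →ₗ[ℝ] ℝ}
    (h : ∀ P ∈ s, ∀ Q ∈ s, F P + l P (Q - P) ≤ F Q) : ConvexOn ℝ s F := by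
  refine ⟨hs, fun x hx y hy a b ha hb hab => ?_⟩
  set z := a • x + b • y with hz
  have hzs : z ∈ s := hs hx hy ha hb hab
  have h1 := mul_le_mul_of_nonneg_left (h z hzs x hx) ha
  have h2 := mul_le_mul_of_nonneg_left (h z hzs y hy) hb
  have h3 : a * l z (x - z) + b * l z (y - z) = 0 := by
    have h4 : a • (x - z) + b • (y - z) = 0 := by
      have : a • (x - z) + b • (y - z) = a • x + b • y - (a + b) • z := by module
      rw [this, hab, one_smul, hz, sub_self]
    rw [← smul_eq_mul, ← smul_eq_mul, ← map_smul, ← map_smul, ← map_add, h4, map_zero]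
  simp only [smul_eq_mul]
  have h5 : F z = a * F z + b * F z := by rw [← add_mul, hab, one_mul]
  linarith

/-- If a function along a curve has a support function from below at every point, with slope at
least `-2 √f σ`, then `√f` decreases at most by the integral of `σ`. -/
theorem sqrt_le_sqrt_add_integral {f σ : ℝ → ℝ} (hf : ContinuousOn f (Icc 0 1))
    (hf0 : ∀ t ∈ Icc (0 : ℝ) 1, 0 ≤ f t) (hσ : Continuous σ)
    {w : ℝ → ℝ → ℝ} {w' : ℝ → ℝ} (hw : ∀ t ∈ Ico (0 : ℝ) 1, ∀ r ∈ Icc (0 : ℝ) 1, w t r ≤ f r)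
    (hwt : ∀ t ∈ Ico (0 : ℝ) 1, w t t = f t)
    (hw' : ∀ t ∈ Ico (0 : ℝ) 1, HasDerivWithinAt (w t) (w' t) (Ioi t) t)
    (hb : ∀ t ∈ Ico (0 : ℝ) 1, -w' t ≤ 2 * √(f t) * σ t) (hσ0 : ∀ t ∈ Ico (0 : ℝ) 1, 0 ≤ σ t) :
    √(f 0) ≤ √(f 1) + ∫ t in (0 : ℝ)..1, σ t := by
  -- Replacing `√f` by `√(f + ε²)` keeps the square root differentiable where `f` vanishes, at a
  -- cost of at most `ε`.
  refine le_of_forall_pos_le_add fun ε hε => ?_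
  have key : ∀ ⦃x⦄, x ∈ Icc (0 : ℝ) 1 →
      -√(f x + ε ^ 2) ≤ -√(f 0 + ε ^ 2) + ∫ t in (0 : ℝ)..x, σ t := by
    have hI : ∀ x, HasDerivAt (fun x => -√(f 0 + ε ^ 2) + ∫ t in (0 : ℝ)..x, σ t) (σ x) x :=
      fun x => (hσ.integral_hasStrictDerivAt 0 x).hasDerivAt.const_add _
    -- Only right slopes have to be controlled, so `f` need not be differentiable: as `w t ≤ f` with
    -- equality at `t`, the right slopes of `-√(f + ε²)` at `t` are at most those of `-√(w t + ε²)`.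
    refine image_le_of_liminf_slope_right_le_deriv_boundary (B' := σ)
      (by fun_prop) (by simp) (fun x _ => (hI x).continuousAt.continuousWithinAt)
      (fun x _ => (hI x).hasDerivWithinAt) fun t ht r hr => ?_
    have hft := hf0 t (Ico_subset_Icc_self ht)
    have hpos : 0 < f t + ε ^ 2 := by positivity
    have h1 : HasDerivWithinAt (fun r => -√(w t r + ε ^ 2))
        (-(w' t / (2 * √(w t t + ε ^ 2)))) (Ioi t) t :=
      (((hw' t ht).add_const (ε ^ 2)).sqrt (by rw [hwt t ht]; exact hpos.ne')).neg
    have h2 : -(w' t / (2 * √(w t t + ε ^ 2))) ≤ σ t := by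
      rw [hwt t ht, ← neg_div, div_le_iff₀ (by positivity)]
      refine (hb t ht).trans ?_
      have h3 : √(f t) ≤ √(f t + ε ^ 2) := Real.sqrt_le_sqrt (by nlinarith)
      nlinarith [hσ0 t ht]
    have h3 := h1.limsup_slope_le' (lt_irrefl t) (h2.trans_lt hr)
    refine (Filter.Eventually.frequently ?_)
    filter_upwards [h3, Ioc_mem_nhdsGT ht.2] with z hz hz1
    refine lt_of_le_of_lt ?_ hz
    have hzt : 0 < z - t := sub_pos.2 hz1.1
    rw [slope_def_field, slope_def_field, hwt t ht]
    have h4 : √(w t z + ε ^ 2) ≤ √(f z + ε ^ 2) :=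
      Real.sqrt_le_sqrt (by linarith [hw t ht z ⟨ht.1.trans hz1.1.le, hz1.2⟩])
    gcongr
  have h1 := key (right_mem_Icc.2 zero_le_one)
  have h2 : √(f 0) ≤ √(f 0 + ε ^ 2) := Real.sqrt_le_sqrt (by nlinarith)
  have h3 : √(f 1 + ε ^ 2) ≤ √(f 1) + ε := by
    have h0 := hf0 1 (right_mem_Icc.2 zero_le_one)
    rw [Real.sqrt_le_left (by positivity)]
    nlinarith [Real.sq_sqrt h0, Real.sqrt_nonneg (f 1)]
  linarith

namespace LyapunovData

variable {E : Type*} [NormedAddCommGroup E] [NormedSpace ℝ E] [FiniteDimensional ℝ E]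
  {U : TopologicalSpace.Opens E} (D : LyapunovData U)

/-- A nonnegative function `F` with supporting hyperplanes whose slopes are bounded by `2 √F` times
the Riemannian norm gives a lower bound `√F` for the distance to a zero of `F`. -/
theorem ofReal_sqrt_le_dist (hU : Convex ℝ (U : Set E)) {F : E → ℝ} {l : E → E →ₗ[ℝ] ℝ}
    (hF0 : ∀ P ∈ U, 0 ≤ F P) (hl : ∀ P ∈ U, ∀ Q ∈ U, F P + l P (Q - P) ≤ F Q)
    (hgrad : ∀ P : U, ∀ V : E, -l P V ≤ 2 * √(F P) * √(D.metric.form P V V))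
    (x y : U) (hy : F y = 0) : ENNReal.ofReal √(F x) ≤ D.metric.dist x y := by
  refine le_of_forall_gt fun r hr => ?_
  obtain ⟨γ, rfl, rfl, hγ, hlen⟩ := D.metric.exists_length_lt hr
  refine lt_of_le_of_lt ?_ hlen
  set v : ℝ → E := derivWithin (fun t => (γ t : E)) (Icc 0 1) with hv
  have hγ' : ∀ t ∈ Icc (0 : ℝ) 1, HasDerivWithinAt (fun t => (γ t : E)) (v t) (Icc 0 1) t :=
    fun t ht => (hγ.differentiableOn one_ne_zero t ht).hasDerivWithinAt
  have hvc : ContinuousOn v (Icc 0 1) :=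
    hγ.continuousOn_derivWithin (uniqueDiffOn_Icc zero_lt_one) le_rfl
  have hσc : ContinuousOn (fun t => √(D.metric.form (γ t) (v t) (v t))) (Icc 0 1) := by
    have h1 : ContinuousOn (fun t => D.bilin (γ t)) (Icc 0 1) :=
      (D.contDiffOn_bilin (k := 0)).continuousOn.comp hγ.continuousOn fun t _ => (γ t).2
    exact ((h1.clm_apply hvc).clm_apply hvc).sqrt
  -- The speed is extended by its endpoint values, so that it is continuous on the whole line.
  set σ : ℝ → ℝ := IccExtend zero_le_one
    ((Icc (0 : ℝ) 1).domRestrict fun t => √(D.metric.form (γ t) (v t) (v t))) with hσ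
  have hσ' : Continuous σ := (continuousOn_iff_continuous_domRestrict.1 hσc).Icc_extend'
  have hσe : ∀ t ∈ Icc (0 : ℝ) 1, σ t = √(D.metric.form (γ t) (v t) (v t)) := fun t ht => by
    rw [hσ, IccExtend_of_mem _ _ ht]; rfl
  have hσ0 : ∀ t, 0 ≤ σ t := fun t => Real.sqrt_nonneg _
  rw [D.metric.length_eq_lintegral zero_lt_one hγ hγ',
    setLIntegral_congr_fun measurableSet_Icc
      (fun t ht => congrArg ENNReal.ofReal (hσe t ht).symm),
    ← ofReal_integral_eq_lintegral_ofReal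
      (hσ'.continuousOn.integrableOn_compact isCompact_Icc) (Filter.Eventually.of_forall hσ0),
    integral_Icc_eq_integral_Ioc, ← intervalIntegral.integral_of_le zero_le_one]
  refine ENNReal.ofReal_le_ofReal ?_
  -- Continuity of `F` comes for free: a convex function on an open set in finite dimension is
  -- continuous.
  have hFc : ContinuousOn F U := (convexOn_of_support hU hl).continuousOn U.isOpen
  have h := sqrt_le_sqrt_add_integral (f := fun t => F (γ t)) (σ := σ)
    (w := fun t r => F (γ t) + l (γ t) (γ r - γ t)) (w' := fun t => l (γ t) (v t))
    (hFc.comp hγ.continuousOn fun t _ => (γ t).2) (fun t _ => hF0 _ (γ t).2) hσ'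
    (fun t _ r _ => hl _ (γ t).2 _ (γ r).2) (fun t _ => by simp)
    (fun t ht => ?_) (fun t ht => ?_) (fun t _ => hσ0 t)
  · simpa [hy] using h
  · have h1 : HasDerivWithinAt (fun r => (γ r : E)) (v t) (Ioi t) t :=
      (hγ' t (Ico_subset_Icc_self ht)).mono_of_mem_nhdsWithin
        (Filter.mem_of_superset (Ioc_mem_nhdsGT ht.2)
          fun z hz => ⟨ht.1.trans hz.1.le, hz.2⟩)
    exact ((LinearMap.toContinuousLinearMap (l (γ t))).hasFDerivAt.comp_hasDerivWithinAt t
      (h1.sub_const (γ t : E))).const_add (F (γ t))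
  · rw [hσe t (Ico_subset_Icc_self ht)]
    exact hgrad (γ t) (v t)

/-- The curve `A + t B + t² C` is a geodesic if `2 C = v X - (1/2) γ (X X)` for
some `X` with `γ X = v = B + 2 t C`. -/
theorem isGeodesicOn_quadratic {A B C : E} {γ : ℝ → U} {s : Set ℝ} {X : ℝ → E}
    (hγ : ∀ t ∈ s, (γ t : E) = A + t • B + t ^ 2 • C)
    (hX : ∀ t ∈ s, D.mul (γ t) (X t) = B + (2 * t) • C)
    (hC : ∀ t ∈ s, (2 : ℝ) • C
      = D.mul (B + (2 * t) • C) (X t) - (1 / 2 : ℝ) • D.mul (γ t) (D.mul (X t) (X t))) :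
    D.metric.IsGeodesicOn γ s := by
  refine ⟨fun t => B + (2 * t) • C, fun _ => (2 : ℝ) • C, fun t ht => ⟨?_, ?_, fun W =>
    D.form_add_christoffel_eq_zero (γ t) (hX t ht) (hC t ht) W⟩⟩
  · refine HasDerivWithinAt.congr_of_mem ?_ hγ ht
    have h1 := ((((hasDerivAt_id t).smul_const B).const_add A).add
      (((hasDerivAt_id t).pow 2).smul_const C)).hasDerivWithinAt (s := s)
    convert! h1 using 1
    simp
  · have h1 := ((((hasDerivAt_id t).const_mul 2).smul_const C).const_add B).hasDerivWithinAt (s := s)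
    convert! h1 using 1
    simp

/-- The velocity is `γ X`, so the squared speed is `form (γ X) X`, which is the constant `c`. -/
theorem length_quadratic {A B C : E} {γ : ℝ → U} {X : ℝ → E} {c : ℝ}
    (hγ : ∀ t ∈ Icc (0 : ℝ) 1, (γ t : E) = A + t • B + t ^ 2 • C)
    (hX : ∀ t ∈ Icc (0 : ℝ) 1, D.mul (γ t) (X t) = B + (2 * t) • C)
    (hc : ∀ t ∈ Icc (0 : ℝ) 1, D.form (D.mul (γ t) (X t)) (X t) = c) :
    ContDiffOn ℝ 1 (fun t => (γ t : E)) (Icc 0 1) ∧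
      D.metric.length γ 0 1 = ENNReal.ofReal √c := by
  have hd : ContDiffOn ℝ 1 (fun t => (γ t : E)) (Icc 0 1) :=
    ContDiffOn.congr (f := fun t : ℝ => A + t • B + t ^ 2 • C) (by fun_prop) hγ
  refine ⟨hd, ?_⟩
  rw [D.metric.length_eq_lintegral (v := fun t => B + (2 * t) • C) zero_lt_one hd]
  · rw [setLIntegral_congr_fun (g := fun _ => ENNReal.ofReal √c) measurableSet_Icc fun t ht => ?_]
    · simp
    · simp only
      rw [← hX t ht, D.metric_form_mul, hc t ht]
  · intro t ht
    refine HasDerivWithinAt.congr_of_mem ?_ hγ ht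
    have h1 := ((((hasDerivAt_id t).smul_const B).const_add A).add
      (((hasDerivAt_id t).pow 2).smul_const C)).hasDerivWithinAt (s := Icc 0 1)
    convert! h1 using 1
    simp

end LyapunovData

end BuresWasserstein

/-! ### Hermitian matrices: trace form, symmetrized product, eigenbasis formula -/

namespace BuresWasserstein

open Set

/-- Cauchy-Schwarz for the form `(X, Y) ↦ form (A X) Y`, from the discriminant of the nonnegative
quadratic at `s X + Y`. -/
theorem LyapunovData.neg_form_mul_le {E : Type*} [NormedAddCommGroup E] [NormedSpace ℝ E]
    {U : TopologicalSpace.Opens E} (D : LyapunovData U) {A : E} (hA : A ∈ U) (X Y : E) :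
    -D.form (D.mul A X) Y ≤ √(D.form (D.mul A X) X) * √(D.form (D.mul A Y) Y) := by
  have hnn : ∀ Z : E, 0 ≤ D.form (D.mul A Z) Z := fun Z => by
    rcases eq_or_ne Z 0 with rfl | hZ
    · simp
    · exact (D.form_mul_self_pos hA hZ).le
  have hs : D.form (D.mul A Y) X = D.form (D.mul A X) Y := by
    rw [D.form_mul_left, D.form_symm]
  have h := discrim_le_zero (a := D.form (D.mul A X) X) (b := 2 * D.form (D.mul A X) Y)
    (c := D.form (D.mul A Y) Y) fun s => by
      have h1 := hnn (s • X + Y)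
      simp only [map_add, map_smul, LinearMap.add_apply, LinearMap.smul_apply, smul_eq_mul,
        hs] at h1
      linarith
  rw [discrim] at h
  rw [← Real.sqrt_mul (hnn X)]
  refine (neg_le_abs _).trans (Real.abs_le_sqrt ?_)
  linarith

variable {n : ℕ}

theorem Herm.isHermitian (X : Herm n) : (X : Matrix (Fin n) (Fin n) ℂ).IsHermitian := X.2

/-- The symmetrized product `A X + X A` of Hermitian matrices. -/
noncomputable def jordan (n : ℕ) : Herm n →ₗ[ℝ] Herm n →ₗ[ℝ] Herm n :=
  LinearMap.mk₂ ℝ (fun A X : Herm n => (⟨A * X + X * A, by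
      have hA := (Herm.isHermitian A).eq
      have hX := (Herm.isHermitian X).eq
      change star _ = _
      rw [Matrix.star_eq_conjTranspose, Matrix.conjTranspose_add, Matrix.conjTranspose_mul,
        Matrix.conjTranspose_mul, hA, hX, add_comm]⟩ : Herm n))
    (fun A B X => Subtype.ext (by simp [add_mul, mul_add]; abel))
    (fun c A X => Subtype.ext (by simp))
    (fun A X Y => Subtype.ext (by simp [add_mul, mul_add]; abel))
    (fun c A X => Subtype.ext (by simp))

theorem coe_jordan (A X : Herm n) :
    (jordan n A X : Matrix (Fin n) (Fin n) ℂ) = A * X + X * A := rfl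

/-- The inner product `(1/2) tr (Y X)` of Hermitian matrices. -/
noncomputable def trForm (n : ℕ) : Herm n →ₗ[ℝ] Herm n →ₗ[ℝ] ℝ :=
  LinearMap.mk₂ ℝ (fun Y X : Herm n =>
      ((Y : Matrix (Fin n) (Fin n) ℂ) * (X : Matrix (Fin n) (Fin n) ℂ)).trace.re / 2)
    (fun A B X => by simp [add_mul, add_div])
    (fun c A X => by simp [mul_div_assoc])
    (fun A X Y => by simp [mul_add, add_div])
    (fun c A X => by simp [mul_div_assoc])

theorem trForm_apply (Y X : Herm n) :
    trForm n Y X = ((Y : Matrix (Fin n) (Fin n) ℂ) * (X : Matrix (Fin n) (Fin n) ℂ)).trace.re / 2 :=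
  rfl

theorem trForm_symm (Y X : Herm n) : trForm n Y X = trForm n X Y := by
  rw [trForm_apply, trForm_apply, Matrix.trace_mul_comm]

theorem trForm_jordan_left (A X Y : Herm n) :
    trForm n (jordan n A X) Y = trForm n X (jordan n A Y) := by
  simp only [trForm_apply, coe_jordan, add_mul, mul_add, Matrix.trace_add]
  rw [add_comm, ← mul_assoc, ← mul_assoc, Matrix.mul_assoc (A : Matrix (Fin n) (Fin n) ℂ),
    Matrix.trace_mul_comm (A : Matrix (Fin n) (Fin n) ℂ)]

/-- The two halves of `A X + X A` have the same trace against `X`, which absorbs the factor `1/2` in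
`trForm`. -/
theorem trForm_jordan_self (A X : Herm n) : trForm n (jordan n A X) X
    = ((X : Matrix (Fin n) (Fin n) ℂ) * A * X).trace.re := by
  simp only [trForm_apply, coe_jordan, add_mul, Matrix.trace_add, Complex.add_re]
  rw [Matrix.mul_assoc, Matrix.trace_mul_comm, Matrix.mul_assoc,
    Matrix.trace_mul_comm (X : Matrix (Fin n) (Fin n) ℂ), Matrix.mul_assoc]
  ring

theorem posDef_sqrt {A : Matrix (Fin n) (Fin n) ℂ} (hA : A.PosDef) : (CFC.sqrt A).PosDef :=
  Matrix.isStrictlyPositive_iff_posDef.1 (Matrix.isStrictlyPositive_iff_posDef.2 hA).sqrt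

theorem sqrt_mul_sqrt {A : Matrix (Fin n) (Fin n) ℂ} (hA : A.PosDef) :
    CFC.sqrt A * CFC.sqrt A = A :=
  CFC.sqrt_mul_sqrt_self A hA.posSemidef.nonneg

theorem posSemidef_conj {A X : Matrix (Fin n) (Fin n) ℂ} (hA : A.PosSemidef)
    (hX : X.IsHermitian) : (X * A * X).PosSemidef := by
  have h := hA.mul_mul_conjTranspose_same X
  rwa [hX.eq] at h

theorem posDef_conj {A X : Matrix (Fin n) (Fin n) ℂ} (hA : A.PosDef) (hX : X.PosDef) :
    (X * A * X).PosDef := by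
  have h := hA.mul_mul_conjTranspose_same (B := X) (Matrix.vecMul_injective_of_isUnit hX.isUnit)
  rwa [hX.isHermitian.eq] at h

theorem trace_re_nonneg {A : Matrix (Fin n) (Fin n) ℂ} (hA : A.PosSemidef) : 0 ≤ A.trace.re :=
  (Complex.le_def.1 hA.trace_nonneg).1

/-- With `P = A^{1/2}`, the trace is the squared Frobenius norm of `P X`, and `P` is invertible. -/
theorem eq_zero_of_trace_conj_eq_zero {A X : Matrix (Fin n) (Fin n) ℂ} (hA : A.PosDef)
    (hX : X.IsHermitian) (h : (X * A * X).trace.re = 0) : X = 0 := by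
  have h1 := (posSemidef_conj hA.posSemidef hX).trace_nonneg
  have h2 : (X * A * X).trace = 0 := Complex.ext h (Complex.le_def.1 h1).2.symm
  set P := CFC.sqrt A
  have hP : P.PosDef := posDef_sqrt hA
  have h3 : (P * X)ᴴ * (P * X) = X * A * X := by
    rw [Matrix.conjTranspose_mul, hP.isHermitian.eq, hX.eq, ← sqrt_mul_sqrt hA]
    simp only [mul_assoc, P]
  rw [← h3, Matrix.trace_conjTranspose_mul_self_eq_zero_iff] at h2
  exact hP.isUnit.mul_right_eq_zero.1 h2

/-- The inner product `(1/2) tr (Y X)` and the product `A X + X A` on Hermitian matrices. -/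
noncomputable def bwData (n : ℕ) : LyapunovData (Pos n) where
  form := trForm n
  mul := jordan n
  form_symm := trForm_symm
  mul_comm A X := Subtype.ext (by simp only [coe_jordan, add_comm])
  form_mul_left := trForm_jordan_left
  form_mul_self_pos {A} hA {X} hX := by
    rw [trForm_jordan_self]
    exact (trace_re_nonneg (posSemidef_conj (Matrix.PosDef.posSemidef hA)
      (Herm.isHermitian X))).lt_of_ne' fun h =>
      hX (Subtype.ext (eq_zero_of_trace_conj_eq_zero hA (Herm.isHermitian X) h))

theorem trace_unitary_conj {U : Matrix (Fin n) (Fin n) ℂ} (hU : U ∈ Matrix.unitaryGroup (Fin n) ℂ)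
    (Y X : Matrix (Fin n) (Fin n) ℂ) : (Uᴴ * Y * U * (Uᴴ * X * U)).trace = (Y * X).trace := by
  have h1 : U * Uᴴ = 1 := Matrix.mem_unitaryGroup_iff.1 hU
  have h2 : Uᴴ * Y * U * (Uᴴ * X * U) = Uᴴ * (Y * X * U) := by
    calc _ = Uᴴ * Y * (U * Uᴴ) * X * U := by simp only [mul_assoc]
      _ = _ := by rw [h1]; simp only [mul_assoc, Matrix.mul_one]
  rw [h2, Matrix.trace_mul_comm, Matrix.mul_assoc, h1, Matrix.mul_one]

/-- In the eigenbasis `x_ij = z_ij / (α_i + α_j)`, so the real part of the trace is the sum of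
`Re(conj(y_ji) z_ji) / (α_i + α_j)`. Half of it is `eigenbasisForm` because `α_i + α_j` cancels one
factor of the denominator once the sum is averaged with its transpose. -/
theorem trace_mul_re_eq_eigenbasisForm {A U : Matrix (Fin n) (Fin n) ℂ} {α : Fin n → ℝ}
    (hA : A.PosDef) (hU : U ∈ Matrix.unitaryGroup (Fin n) ℂ)
    (hAU : A = U * Matrix.diagonal (fun i => (α i : ℂ)) * Uᴴ)
    {X Y Z : Matrix (Fin n) (Fin n) ℂ} (hY : Y.IsHermitian) (hZ : Z.IsHermitian)
    (hX : A * X + X * A = Z) : (Y * X).trace.re / 2 = eigenbasisForm U α Y Z := by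
  have h1 : U * Uᴴ = 1 := Matrix.mem_unitaryGroup_iff.1 hU
  have h2 : Uᴴ * U = 1 := Matrix.mem_unitaryGroup_iff'.1 hU
  have hD : Uᴴ * A * U = Matrix.diagonal (fun i => (α i : ℂ)) := by
    rw [hAU]
    calc _ = (Uᴴ * U) * Matrix.diagonal (fun i => (α i : ℂ)) * (Uᴴ * U) := by
          simp only [mul_assoc]
      _ = _ := by rw [h2]; simp
  have hα : ∀ i, 0 < α i := by
    have hUu : IsUnit U := ⟨⟨U, Uᴴ, h1, h2⟩, rfl⟩
    have h3 := hA.conjTranspose_mul_mul_same (B := U) (Matrix.mulVec_injective_of_isUnit hUu)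
    rw [hD, Matrix.posDef_diagonal_iff] at h3
    exact fun i => by simpa using h3 i
  set x := Uᴴ * X * U with hx
  set y := Uᴴ * Y * U with hy
  set z := Uᴴ * Z * U with hz
  have hyH : y.IsHermitian := Matrix.isHermitian_conjTranspose_mul_mul U hY
  have hzH : z.IsHermitian := Matrix.isHermitian_conjTranspose_mul_mul U hZ
  have hxz : Matrix.diagonal (fun i => (α i : ℂ)) * x + x * Matrix.diagonal (fun i => (α i : ℂ))
      = z := by
    rw [← hD, hx, hz, ← hX]
    calc _ = Uᴴ * A * (U * Uᴴ) * X * U + Uᴴ * X * (U * Uᴴ) * A * U := by simp only [mul_assoc]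
      _ = _ := by rw [h1]; simp only [Matrix.mul_one, mul_add, add_mul, mul_assoc]
  have hxe : ∀ i j, x i j = (((α i + α j)⁻¹ : ℝ) : ℂ) * z i j := by
    intro i j
    have h3 := congrFun (congrFun hxz i) j
    rw [Matrix.add_apply, Matrix.diagonal_mul, Matrix.mul_diagonal] at h3
    have h4 : ((α i + α j : ℝ) : ℂ) ≠ 0 :=
      Complex.ofReal_ne_zero.2 (add_pos (hα i) (hα j)).ne'
    rw [← h3]
    push_cast at h4 ⊢
    field_simp
  have hswap : ∀ i j, (star (y i j) * z i j).re = (star (y j i) * z j i).re := by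
    intro i j
    rw [← hyH.apply i j, ← hzH.apply i j]
    simp
  rw [← trace_unitary_conj hU, Matrix.trace]
  have hE : eigenbasisForm U α Y Z
      = ∑ i, ∑ j, α i * (star (y j i) * z j i).re / (α i + α j) ^ 2 := rfl
  -- Exchanging `i` and `j` conjugates both entries and leaves the real part unchanged, so the
  -- weight `α_i` may be replaced by `α_j`.
  have hE' : eigenbasisForm U α Y Z
      = ∑ i, ∑ j, α j * (star (y j i) * z j i).re / (α i + α j) ^ 2 := by
    rw [hE, Finset.sum_comm]
    refine Finset.sum_congr rfl fun i _ => Finset.sum_congr rfl fun j _ => ?_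
    rw [hswap i j, add_comm (α j)]
  have hS : (∑ i, (y * x).diag i).re
      = ∑ i, ∑ j, (star (y j i) * z j i).re / (α i + α j) := by
    rw [Complex.re_sum]
    refine Finset.sum_congr rfl fun i _ => ?_
    rw [Matrix.diag_apply, Matrix.mul_apply, Complex.re_sum]
    refine Finset.sum_congr rfl fun j _ => ?_
    rw [hxe, ← hyH.apply i j, mul_left_comm, Complex.re_ofReal_mul, add_comm (α j),
      inv_mul_eq_div]
  rw [div_eq_iff two_ne_zero, mul_two]
  nth_rw 1 [hE]
  rw [hE', hS, ← Finset.sum_add_distrib]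
  refine Finset.sum_congr rfl fun i _ => ?_
  rw [← Finset.sum_add_distrib]
  refine Finset.sum_congr rfl fun j _ => ?_
  have h4 := (add_pos (hα i) (hα j)).ne'
  field_simp

theorem metric_form_eq_eigenbasisForm (A : Pos n) {U : Matrix (Fin n) (Fin n) ℂ} {α : Fin n → ℝ}
    (hU : U ∈ Matrix.unitaryGroup (Fin n) ℂ)
    (hAU : toMat A = U * Matrix.diagonal (fun i => (α i : ℂ)) * Uᴴ) (Y Z : Herm n) :
    (bwData n).metric.form A Y Z = eigenbasisForm U α Y Z := by
  refine ((bwData n).metric_form A Y Z).trans ?_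
  refine trace_mul_re_eq_eigenbasisForm A.2 hU hAU (Herm.isHermitian Y) (Herm.isHermitian Z) ?_
  exact congrArg Subtype.val ((bwData n).mul_lyap A.2 Z)

end BuresWasserstein

/-! ### Transport matrices and the lower bound for the distance -/

namespace BuresWasserstein

open Set

variable {n : ℕ}

/-- The squared Bures-Wasserstein distance. -/
noncomputable def bwSq (A B : Matrix (Fin n) (Fin n) ℂ) : ℝ :=
  (A.trace + B.trace - 2 * (CFC.sqrt (CFC.sqrt A * B * CFC.sqrt A)).trace).re

theorem sqrt_bwSq (A B : Matrix (Fin n) (Fin n) ℂ) : √(bwSq A B) = bwDist A B := rfl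

/-- With `P = A^{1/2}` and `C = (P B P)^{1/2}`, the matrix is `S = P⁻¹ C P⁻¹`, the optimal transport
map between the centred Gaussians of covariances `A` and `B`. It turns the fidelity `tr C` into `tr
(S A)`. -/
theorem exists_transport {A B : Matrix (Fin n) (Fin n) ℂ} (hA : A.PosDef) (hB : B.PosDef) :
    ∃ S : Matrix (Fin n) (Fin n) ℂ, S.PosDef ∧ S * A * S = B ∧
      (CFC.sqrt (CFC.sqrt A * B * CFC.sqrt A)).trace = (S * A).trace := by
  have hP : (CFC.sqrt A).PosDef := posDef_sqrt hA
  have hPP := sqrt_mul_sqrt hA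
  set P := CFC.sqrt A
  have hPBP : (P * B * P).PosDef := posDef_conj hB hP
  have hC := posDef_sqrt hPBP
  have hCC := sqrt_mul_sqrt hPBP
  set C := CFC.sqrt (P * B * P)
  have h1 : P⁻¹ * P = 1 := Matrix.nonsing_inv_mul _ ((Matrix.isUnit_iff_isUnit_det P).1 hP.isUnit)
  have h2 : P * P⁻¹ = 1 := Matrix.mul_nonsing_inv _ ((Matrix.isUnit_iff_isUnit_det P).1 hP.isUnit)
  refine ⟨P⁻¹ * C * P⁻¹, posDef_conj hC hP.inv, ?_, ?_⟩
  · calc _ = P⁻¹ * C * (P⁻¹ * P) * (P * P⁻¹) * C * P⁻¹ := by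
          rw [← hPP]; simp only [mul_assoc]
      _ = P⁻¹ * (C * C) * P⁻¹ := by rw [h1, h2]; simp only [Matrix.mul_one, mul_assoc]
      _ = (P⁻¹ * P) * B * (P * P⁻¹) := by rw [hCC]; simp only [mul_assoc]
      _ = B := by rw [h1, h2, Matrix.one_mul, Matrix.mul_one]
  · have h3 : P⁻¹ * C * P⁻¹ * A = P⁻¹ * (C * P) := by
      calc _ = P⁻¹ * C * (P⁻¹ * P) * P := by rw [← hPP]; simp only [mul_assoc]
        _ = _ := by rw [h1]; simp only [Matrix.mul_one, mul_assoc]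
    rw [h3, Matrix.trace_mul_comm, mul_assoc, h2, Matrix.mul_one]

theorem bwSq_eq_trace {A B S : Matrix (Fin n) (Fin n) ℂ} (hS : S * A * S = B)
    (hC : (CFC.sqrt (CFC.sqrt A * B * CFC.sqrt A)).trace = (S * A).trace) :
    bwSq A B = ((1 - S) * A * (1 - S)).trace.re := by
  have h : (1 - S) * A * (1 - S) = A + S * A * S - S * A - A * S := by noncomm_ring
  rw [bwSq, hC, h, hS]
  simp only [Matrix.trace_sub, Matrix.trace_add, Matrix.trace_mul_comm A S]
  ring_nf

theorem bwSq_self {A : Matrix (Fin n) (Fin n) ℂ} (hA : A.PosDef) : bwSq A A = 0 := by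
  have h : CFC.sqrt (CFC.sqrt A * A * CFC.sqrt A) = A := by
    have h1 : CFC.sqrt A * A * CFC.sqrt A = A * A := by
      calc _ = CFC.sqrt A * (CFC.sqrt A * CFC.sqrt A) * CFC.sqrt A := by rw [sqrt_mul_sqrt hA]
        _ = (CFC.sqrt A * CFC.sqrt A) * (CFC.sqrt A * CFC.sqrt A) := by simp only [mul_assoc]
        _ = _ := by rw [sqrt_mul_sqrt hA]
    rw [h1]
    exact CFC.sqrt_mul_self A hA.posSemidef.nonneg
  rw [bwSq, h]
  ring_nf
  simp

theorem bwSq_nonneg {A B : Matrix (Fin n) (Fin n) ℂ} (hA : A.PosDef) (hB : B.PosDef) :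
    0 ≤ bwSq A B := by
  obtain ⟨S, hS, hSB, hC⟩ := exists_transport hA hB
  rw [bwSq_eq_trace hSB hC]
  exact trace_re_nonneg (posSemidef_conj hA.posSemidef
    (Matrix.isHermitian_one.sub hS.isHermitian))

theorem trace_mul_re_nonneg {A B : Matrix (Fin n) (Fin n) ℂ} (hA : A.PosDef)
    (hB : B.PosSemidef) : 0 ≤ (A * B).trace.re := by
  rw [← sqrt_mul_sqrt hA, mul_assoc, Matrix.trace_mul_comm]
  exact trace_re_nonneg (posSemidef_conj hB (posDef_sqrt hA).isHermitian)

/-- The variational inequality behind the concavity of the fidelity. -/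
theorem two_mul_trace_transport_le {P Q S T : Matrix (Fin n) (Fin n) ℂ} (hQ : Q.PosDef)
    (hS : S.PosDef) (hT : T.PosDef) (h : T * Q * T = S * P * S) :
    2 * (T * Q).trace.re ≤ (S * Q).trace.re + (S * P).trace.re := by
  have hu := (Matrix.isUnit_iff_isUnit_det S).1 hS.isUnit
  have h1 : S⁻¹ * S = 1 := Matrix.nonsing_inv_mul _ hu
  have h2 : S * S⁻¹ = 1 := Matrix.mul_nonsing_inv _ hu
  -- The inequality is the expansion of `Re tr (Q (T - S) S⁻¹ (T - S)) ≥ 0`, where `tr (Q T S⁻¹ T) =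
  -- tr (S P)` because `T Q T = S P S`.
  have h3 := trace_mul_re_nonneg hQ (posSemidef_conj hS.inv.posSemidef
    (hT.isHermitian.sub hS.isHermitian))
  have h4 : (T - S) * S⁻¹ * (T - S) = T * S⁻¹ * T - T - T + S := by
    calc _ = T * S⁻¹ * T - T * (S⁻¹ * S) - (S * S⁻¹) * T + (S * S⁻¹) * S := by noncomm_ring
      _ = _ := by rw [h1, h2]; simp only [Matrix.mul_one, Matrix.one_mul]
  have h5 : (Q * (T * S⁻¹ * T)).trace = (S * P).trace := by
    calc _ = (T * Q * T * S⁻¹).trace := by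
          rw [Matrix.trace_mul_comm, ← Matrix.trace_mul_cycle]; simp only [mul_assoc]
      _ = (S * P * (S * S⁻¹)).trace := by rw [h]; simp only [mul_assoc]
      _ = _ := by rw [h2, Matrix.mul_one]
  rw [h4] at h3
  simp only [mul_add, mul_sub, Matrix.trace_add, Matrix.trace_sub, h5, Matrix.trace_mul_comm Q,
    Complex.add_re, Complex.sub_re] at h3
  linarith

theorem convex_pos (n : ℕ) : Convex ℝ (Pos n : Set (Herm n)) := by
  refine convex_iff_forall_pos.2 fun A hA B hB a b ha hb _ => ?_
  have hA' : (A : Matrix (Fin n) (Fin n) ℂ).PosDef := hA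
  have hB' : (B : Matrix (Fin n) (Fin n) ℂ).PosDef := hB
  change ((a • A + b • B : Herm n) : Matrix (Fin n) (Fin n) ℂ).PosDef
  exact (hA'.smul ha).add (hB'.smul hb)

theorem ofReal_bwDist_le_dist (A B : Pos n) :
    ENNReal.ofReal (bwDist (toMat A) (toMat B)) ≤ (bwData n).metric.dist A B := by
  have hB : (toMat B).PosDef := B.2
  have hex : ∀ P : Herm n, ∃ S : Herm n, P ∈ Pos n →
      (S : Matrix (Fin n) (Fin n) ℂ).PosDef ∧ (S : Matrix (Fin n) (Fin n) ℂ) * (P : Matrix (Fin n) (Fin n) ℂ) * (S : Matrix (Fin n) (Fin n) ℂ)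
        = toMat B ∧
      (CFC.sqrt (CFC.sqrt (P : Matrix (Fin n) (Fin n) ℂ) * toMat B *
        CFC.sqrt (P : Matrix (Fin n) (Fin n) ℂ))).trace
        = ((S : Matrix (Fin n) (Fin n) ℂ) * (P : Matrix (Fin n) (Fin n) ℂ)).trace := by
    intro P
    by_cases hP : P ∈ Pos n
    · obtain ⟨S, hS⟩ := exists_transport hP hB
      exact ⟨⟨S, hS.1.isHermitian⟩, fun _ => hS⟩
    · exact ⟨0, fun h => absurd h hP⟩
  choose S hS using hex
  let I : Herm n := ⟨1, Matrix.isHermitian_one⟩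
  -- The factor `2` undoes the `1/2` in `trForm`: the supporting functional at `P` is `V ↦ Re tr ((1
  -- - S P) V)`.
  have hl : ∀ P V : Herm n, (2 : ℝ) • trForm n (I - S P) V
      = ((1 - (S P : Matrix (Fin n) (Fin n) ℂ)) * (V : Matrix (Fin n) (Fin n) ℂ)).trace.re := by
    intro P V
    rw [trForm_apply, smul_eq_mul, mul_div_cancel₀ _ two_ne_zero]
    rfl
  rw [← sqrt_bwSq]
  refine LyapunovData.ofReal_sqrt_le_dist (bwData n) (convex_pos n)
    (F := fun P => bwSq (P : Matrix (Fin n) (Fin n) ℂ) (toMat B))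
    (l := fun P => (2 : ℝ) • trForm n (I - S P)) (fun P hP => bwSq_nonneg hP hB)
    (fun P hP Q hQ => ?_) (fun P V => ?_) A B (bwSq_self hB)
  · obtain ⟨hSP, hSPB, hSPt⟩ := hS P hP
    obtain ⟨hSQ, hSQB, hSQt⟩ := hS Q hQ
    have hQ' : (Q : Matrix (Fin n) (Fin n) ℂ).PosDef := hQ
    have hPQ := hSQB.trans hSPB.symm
    have h := two_mul_trace_transport_le hQ' hSP hSQ hPQ
    have hl' := hl P (Q - P)
    rw [LinearMap.smul_apply, hl', bwSq, bwSq, hSPt, hSQt]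
    simp only [Submodule.coe_sub, sub_mul, mul_sub, Matrix.one_mul, Matrix.trace_sub,
      Complex.add_re, Complex.sub_re, Complex.mul_re, Complex.re_ofNat, Complex.im_ofNat,
      zero_mul, sub_zero]
    linarith
  · obtain ⟨hSP, hSPB, hSPt⟩ := hS P P.2
    -- In this Cauchy-Schwarz inequality the first factor is `√F`, as `tr ((1 - S) P (1 - S)) = F
    -- P`, and the second is the Riemannian norm of `V`.
    have h := (bwData n).neg_form_mul_le P.2 (I - S P) ((bwData n).lyap P V)
    have h1 : (bwData n).form ((bwData n).mul P (I - S P)) (I - S P)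
        = bwSq (P : Matrix (Fin n) (Fin n) ℂ) (toMat B) := by
      rw [bwSq_eq_trace hSPB hSPt]
      exact trForm_jordan_self _ _
    have h2 := (bwData n).mul_lyap P.2 V
    have h3 : (bwData n).metric.form P V V
        = (bwData n).form ((bwData n).mul P ((bwData n).lyap P V)) ((bwData n).lyap P V) := by
      rw [h2]; exact (bwData n).metric_form P V V
    rw [h1, ← h3, (bwData n).form_mul_left, h2] at h
    have h4 : (bwData n).form (I - S P) V = trForm n (I - S P) V := rfl
    rw [h4] at h
    rw [LinearMap.smul_apply, smul_eq_mul]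
    linarith

/-! ### The curve `A ◇_t B` as a minimizing geodesic -/

/-- With `P = A^{1/2}`, `A T` is similar to the positive definite matrix `P T P`, so its eigenvalues
are positive. -/
theorem isPosSqrt_mul {A T : Matrix (Fin n) (Fin n) ℂ} (hA : A.PosDef) (hT : T.PosDef) :
    IsPosSqrt (A * (T * A * T)) (A * T) := by
  refine ⟨by simp only [mul_assoc], ?_⟩
  have hP := posDef_sqrt hA
  have hPP := sqrt_mul_sqrt hA
  set P := CFC.sqrt A
  obtain ⟨u, hu⟩ := hP.isUnit
  have h1 : A * T = u.val * (P * T * P) * (u⁻¹).val := by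
    rw [← hPP, ← hu]
    simp [mul_assoc]
  have hC : (P * T * P).PosDef := posDef_conj hT hP
  intro z hz
  rw [h1, spectrum.units_conjugate, hC.isHermitian.spectrum_eq_image_range] at hz
  obtain ⟨_, ⟨i, rfl⟩, rfl⟩ := hz
  exact Complex.zero_lt_real.2 (hC.eigenvalues_pos i)

theorem diamond_eq_conj {A T : Matrix (Fin n) (Fin n) ℂ} (hA : A.PosDef) (hT : T.PosDef) (t : ℝ) :
    diamond A (T * A * T) t = (1 + t • (T - 1)) * A * (1 + t • (T - 1)) := by
  have hB : (T * A * T).PosDef := posDef_conj hA hT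
  have h1 : posSqrt (A * (T * A * T)) = A * T :=
    (isPosSqrt_posSqrt hA hB).unique (isPosSqrt_mul hA hT)
  have hu := (Matrix.isUnit_iff_isUnit_det T).1 hT.isUnit
  have h3 : T⁻¹ * T = 1 := Matrix.nonsing_inv_mul _ hu
  have h4 : T * T⁻¹ = 1 := Matrix.mul_nonsing_inv _ hu
  -- The roles of the endpoints are exchanged: `T⁻¹` carries `B = T A T` back to `A`, and `B T⁻¹ = T
  -- A`.
  have h2 : posSqrt (T * A * T * A) = T * A := by
    have h5 := isPosSqrt_mul hB hT.inv
    have h6 : T⁻¹ * (T * A * T) * T⁻¹ = A := by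
      calc _ = (T⁻¹ * T) * A * (T * T⁻¹) := by simp only [mul_assoc]
        _ = _ := by rw [h3, h4, Matrix.one_mul, Matrix.mul_one]
    have h7 : T * A * T * T⁻¹ = T * A := by rw [mul_assoc, h4, Matrix.mul_one]
    rw [h6, h7] at h5
    exact (isPosSqrt_posSqrt hB hA).unique h5
  rw [diamond, h1, h2]
  simp only [mul_add, add_mul, mul_sub, sub_mul, smul_mul_assoc, mul_smul_comm, Matrix.one_mul,
    Matrix.mul_one, smul_add, smul_sub, mul_assoc]
  module

/-- For `γ = M A M` with `M = 1 + t D` and `D = T - 1`, the velocity is `γ X + X γ` with `X = D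
M⁻¹`. Hence `X γ X = D A D` does not depend on `t`; this gives both the constant speed and the
geodesic equation. -/
theorem exists_geodesic (A B : Pos n) : ∃ γ : ℝ → Pos n,
    (∀ t ∈ Icc (0 : ℝ) 1, toMat (γ t) = diamond (toMat A) (toMat B) t) ∧ γ 0 = A ∧ γ 1 = B ∧
    (bwData n).metric.IsGeodesicOn γ (Icc 0 1) ∧
    ContDiffOn ℝ 1 (fun t => (γ t : Herm n)) (Icc 0 1) ∧
    (bwData n).metric.length γ 0 1 = ENNReal.ofReal (bwDist (toMat A) (toMat B)) := by
  have hA : (toMat A).PosDef := A.2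
  obtain ⟨T, hT, hTB, hTt⟩ := exists_transport hA (show (toMat B).PosDef from B.2)
  let D : Herm n := ⟨T - 1, hT.isHermitian.sub Matrix.isHermitian_one⟩
  let C : Herm n := ⟨D * toMat A * D, (posSemidef_conj hA.posSemidef D.2).isHermitian⟩
  let M : ℝ → Matrix (Fin n) (Fin n) ℂ := fun t => 1 + t • (T - 1)
  have hM : ∀ t ∈ Icc (0 : ℝ) 1, (M t).PosDef := by
    intro t ht
    have h1 : M t = (1 - t) • (1 : Matrix (Fin n) (Fin n) ℂ) + t • T := by
      simp only [M, smul_sub, sub_smul, one_smul]; abel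
    rw [h1]
    -- At `t = 0` only the summand `1` is definite; for `t > 0` the summand `t T` is, which also
    -- covers `t = 1`.
    rcases ht.1.eq_or_lt with rfl | h0
    · simpa using Matrix.PosDef.one
    · exact (hT.smul h0).posSemidef_add (Matrix.PosSemidef.one.smul (sub_nonneg.2 ht.2))
  have hγ : ∀ t : ℝ, ∃ P : Pos n, t ∈ Icc (0 : ℝ) 1 → toMat P = M t * toMat A * M t := by
    intro t
    by_cases ht : t ∈ Icc (0 : ℝ) 1
    · have h := posDef_conj hA (hM t ht)
      exact ⟨⟨⟨_, h.isHermitian⟩, h⟩, fun _ => rfl⟩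
    · exact ⟨A, fun h => absurd h ht⟩
  choose γ hγ using hγ
  have hX : ∀ t : ℝ, ∃ X : Herm n, t ∈ Icc (0 : ℝ) 1 →
      (X : Matrix (Fin n) (Fin n) ℂ) * M t = D ∧ M t * X = D := by
    intro t
    by_cases ht : t ∈ Icc (0 : ℝ) 1
    · have hu := (Matrix.isUnit_iff_isUnit_det _).1 (hM t ht).isUnit
      have h3 := Matrix.nonsing_inv_mul _ hu
      have h4 := Matrix.mul_nonsing_inv _ hu
      -- `M t` is a polynomial in `D`; commutation makes `D M⁻¹` Hermitian and a two-sided quotient.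
      have hc : M t * (D : Matrix (Fin n) (Fin n) ℂ) = D * M t := by
        simp only [M, D, add_mul, mul_add, smul_mul_assoc, mul_smul_comm, Matrix.one_mul,
          Matrix.mul_one]
      have h5 : (D : Matrix (Fin n) (Fin n) ℂ) * (M t)⁻¹ = (M t)⁻¹ * D := by
        calc _ = ((M t)⁻¹ * M t) * D * (M t)⁻¹ := by rw [h3, Matrix.one_mul]
          _ = (M t)⁻¹ * (M t * D) * (M t)⁻¹ := by simp only [mul_assoc]
          _ = (M t)⁻¹ * D * (M t * (M t)⁻¹) := by rw [hc]; simp only [mul_assoc]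
          _ = _ := by rw [h4, Matrix.mul_one]
      have hH : ((D : Matrix (Fin n) (Fin n) ℂ) * (M t)⁻¹).IsHermitian := by
        rw [Matrix.IsHermitian, Matrix.conjTranspose_mul, (hM t ht).inv.isHermitian.eq,
          (Herm.isHermitian D).eq, h5]
      refine ⟨⟨_, hH⟩, fun _ => ⟨?_, ?_⟩⟩
      · change D * (M t)⁻¹ * M t = (D : Matrix (Fin n) (Fin n) ℂ)
        rw [mul_assoc, h3, Matrix.mul_one]
      · change M t * (D * (M t)⁻¹) = (D : Matrix (Fin n) (Fin n) ℂ)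
        rw [← mul_assoc, hc, mul_assoc, h4, Matrix.mul_one]
    · exact ⟨0, fun h => absurd h ht⟩
  choose X hX using hX
  have hB : toMat B = T * toMat A * T := hTB.symm
  have hγq : ∀ t ∈ Icc (0 : ℝ) 1,
      (γ t : Herm n) = (A : Herm n) + t • jordan n A D + t ^ 2 • C := by
    intro t ht
    refine Subtype.ext ((hγ t ht).trans ?_)
    change M t * toMat A * M t = toMat A + t • (toMat A * (T - 1) + (T - 1) * toMat A)
      + t ^ 2 • ((T - 1) * toMat A * (T - 1))
    simp only [M]
    generalize T - 1 = R
    simp only [mul_add, add_mul, smul_mul_assoc, mul_smul_comm, Matrix.one_mul, Matrix.mul_one,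
      smul_add]
    module
  have hXγ : ∀ t ∈ Icc (0 : ℝ) 1,
      jordan n (γ t) (X t) = jordan n A D + (2 * t) • C := by
    intro t ht
    obtain ⟨h1, h2⟩ := hX t ht
    refine Subtype.ext ?_
    change toMat (γ t) * X t + X t * toMat (γ t)
      = toMat A * D + D * toMat A + (2 * t) • ((D : Matrix (Fin n) (Fin n) ℂ) * toMat A * D)
    calc _ = M t * toMat A * (M t * X t) + (X t * M t) * toMat A * M t := by
          rw [hγ t ht]; simp only [mul_assoc]
      _ = M t * toMat A * D + D * toMat A * M t := by rw [h1, h2]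
      _ = (1 + t • (D : Matrix (Fin n) (Fin n) ℂ)) * toMat A * D
          + D * toMat A * (1 + t • (D : Matrix (Fin n) (Fin n) ℂ)) := rfl
      _ = _ := by
        simp only [mul_add, add_mul, smul_mul_assoc, mul_smul_comm, Matrix.one_mul,
          Matrix.mul_one]
        module
  have hspeed : ∀ t ∈ Icc (0 : ℝ) 1,
      (X t : Matrix (Fin n) (Fin n) ℂ) * toMat (γ t) * X t = D * toMat A * D := by
    intro t ht
    obtain ⟨h1, h2⟩ := hX t ht
    calc _ = (X t * M t) * toMat A * (M t * X t) := by rw [hγ t ht]; simp only [mul_assoc]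
      _ = _ := by rw [h1, h2]
  -- With `v = γ X + X γ`, the terms `γ X²` and `X² γ` cancel on the right, leaving `2 X γ X = 2 D A
  -- D`.
  have hacc : ∀ t ∈ Icc (0 : ℝ) 1, (2 : ℝ) • C = jordan n (jordan n A D + (2 * t) • C) (X t)
      - (1 / 2 : ℝ) • jordan n (γ t) (jordan n (X t) (X t)) := by
    intro t ht
    rw [← hXγ t ht]
    refine Subtype.ext ?_
    change (2 : ℝ) • ((D : Matrix (Fin n) (Fin n) ℂ) * toMat A * D)
      = (toMat (γ t) * X t + X t * toMat (γ t)) * X t + X t * (toMat (γ t) * X t + X t * toMat (γ t))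
      - (1 / 2 : ℝ) • (toMat (γ t) * (X t * X t + X t * X t) + (X t * X t + X t * X t) * toMat (γ t))
    rw [← hspeed t ht]
    simp only [mul_add, add_mul, smul_add, mul_assoc]
    module
  have hlen := (bwData n).length_quadratic (c := bwSq (toMat A) (toMat B)) hγq hXγ fun t ht => by
    refine (trForm_jordan_self (γ t : Herm n) (X t)).trans ?_
    have h1 : ((1 - T) * toMat A * (1 - T)) = (D : Matrix (Fin n) (Fin n) ℂ) * toMat A * D := by
      simp only [D]; noncomm_ring
    rw [bwSq_eq_trace hTB hTt, h1, ← hspeed t ht]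
    rfl
  refine ⟨γ, fun t ht => ?_, ?_, ?_, (bwData n).isGeodesicOn_quadratic hγq hXγ hacc,
    hlen.1, hlen.2⟩
  · rw [hγ t ht, hB, diamond_eq_conj hA hT]
  · refine Subtype.ext (Subtype.ext ((hγ 0 (left_mem_Icc.2 zero_le_one)).trans ?_))
    simp only [M, zero_smul, add_zero, Matrix.one_mul, Matrix.mul_one]
    rfl
  · refine Subtype.ext (Subtype.ext ((hγ 1 (right_mem_Icc.2 zero_le_one)).trans ?_))
    simp only [M, one_smul, add_sub_cancel]
    exact hTB

theorem dist_eq_bwDist (A B : Pos n) :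
    (bwData n).metric.dist A B = ENNReal.ofReal (bwDist (toMat A) (toMat B)) := by
  refine le_antisymm ?_ (ofReal_bwDist_le_dist A B)
  obtain ⟨γ, -, rfl, rfl, -, hc, hl⟩ := exists_geodesic A B
  exact ((bwData n).metric.dist_le_length zero_le_one hc).trans_eq hl

end BuresWasserstein

theorem theorem5 (n : ℕ) :
    ∃ g : RiemMetric (Pos n),
      (∀ (A : Pos n) (U : Matrix (Fin n) (Fin n) ℂ) (α : Fin n → ℝ),
        U ∈ Matrix.unitaryGroup (Fin n) ℂ →
        toMat A = U * Matrix.diagonal (fun i => (α i : ℂ)) * Uᴴ →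
        ∀ Y Z : Herm n, g.form A Y Z = eigenbasisForm U α Y Z) ∧
      (∀ A B : Pos n, g.dist A B = ENNReal.ofReal (bwDist (toMat A) (toMat B))) ∧
      (∀ A B : Pos n, ∃ γ : ℝ → Pos n,
        (∀ t ∈ Set.Icc (0 : ℝ) 1, toMat (γ t) = diamond (toMat A) (toMat B) t) ∧
        γ 0 = A ∧ γ 1 = B ∧
        g.IsGeodesicOn γ (Set.Icc 0 1) ∧
        g.length γ 0 1 = ENNReal.ofReal (bwDist (toMat A) (toMat B))) := by
  refine ⟨(bwData n).metric, fun A U α hU hAU Y Z => metric_form_eq_eigenbasisForm A hU hAU Y Z,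
    dist_eq_bwDist, fun A B => ?_⟩
  obtain ⟨γ, h, h0, h1, hg, -, hl⟩ := exists_geodesic A B
  exact ⟨γ, h, h0, h1, hg, hl⟩
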